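/- Let $G$ be a finite, nonempty, connected graph (loops and parallel edges allowed) of genus $g = \#E(G) - \#V(G) + 1 \ge 1$, let $\ell : E(G) \to \mathbb{R}_{>0}$ be a length function with $\ell(e) \in \mathbb{Q}$ for every edge $e$, and let $\Gamma = (G,\ell)$ be the metric graph obtained by gluing intervals $[0,\ell(e)]$ along $G$. Let $\mathrm{Div}(\Gamma)$ be the free abelian group on the points of $\Gamma$. For a continuous function $f : \Gamma \to \mathbb{R}$ that is piecewise linear with integer slopes (finitely many pieces), let $\mathrm{div}(f) \in \mathrm{Div}(\Gamma)$ be the divisor whose coefficient at each point is the sum of the incoming slopes of $f$. Let $\mathrm{Pic}(\Gamma)$ be the quotient of $\mathrm{Div}(\Gamma)$ by the divisors $\mathrm{div}(f)$, and let $\mathrm{Jac}(\Gamma) \subset \mathrm{Pic}(\Gamma)$ be the group of classes of divisors of degree $0$. Then: 1. $\Gamma$ does not satisfy the Manin--Mumford condition, i.e. it is not true that for every basepoint $q \in \Gamma$ the image of the Abel--Jacobi map $\Gamma \to \mathrm{Jac}(\Gamma)$, $x \mapsto [x-q]$, contains only finitely many torsion points of $\mathrm{Jac}(\Gamma)$.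 2. There is a single degree-one torsion packet, i.e. a set $P = \{[D] : D \text{ effective of degree } 1,\ [D]-c \text{ is a torsion element of } \mathrm{Jac}(\Gamma)\}$ for some effective divisor class $c$ of degree $1$, such that for every integer $m \ge 1$ for which all $m\,\ell(e)$ are integers, the class $[x]$ of every vertex $x$ of the subdivision of $G$ into edges of length $1/m$ lies in $P$; and $P$ is infinite. -/

import Mathlib

open Set

/-- A finite oriented multigraph (loops and parallel edges allowed) with vertex set `V` and edge
set `E`, which is nonempty and connected, together with a positive length for every edge.
It is the combinatorial model `(G, ℓ)` of a metric graph. -/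
structure MetricGraph (V E : Type*) where
  head : E → V
  tail : E → V
  length : E → ℝ
  length_pos : ∀ e, 0 < length e
  nonempty : Nonempty V
  connected : ∀ v w : V, Relation.EqvGen (fun a b => ∃ e, tail e = a ∧ head e = b) v w

namespace MetricGraph

variable {V E : Type*}

/-- The genus `#E - #V + 1`, which is the first Betti number of the (connected) metric graph. -/
def genus [Fintype V] [Fintype E] (_Γ : MetricGraph V E) : ℤ :=
  (Fintype.card E : ℤ) - (Fintype.card V : ℤ) + 1

/-- The points of the metric graph: the closed intervals `[0, ℓ e]` glued along their endpoints to
the vertices. A point is a vertex, or it lies in the open edge `e`, at distance `t` from the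
tail of `e` along `e`. -/
inductive Point (Γ : MetricGraph V E) : Type _
  | vertex (v : V) : Point Γ
  | interior (e : E) (t : ℝ) (h₀ : 0 < t) (h₁ : t < Γ.length e) : Point Γ

open Classical in
/-- The length-preserving parametrisation `[0, ℓ e] → Γ` of the edge `e`, from tail to head
(extended by constants outside of `[0, ℓ e]`). -/
noncomputable def edgePath (Γ : MetricGraph V E) (e : E) (t : ℝ) : Γ.Point :=
  if h₀ : 0 < t then
    if h₁ : t < Γ.length e then Point.interior e t h₀ h₁ else Point.vertex (Γ.head e)
  else Point.vertex (Γ.tail e)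

/-- The quotient topology: the finest one for which all maps `[0, ℓ e] → Γ` are continuous. -/
noncomputable instance (Γ : MetricGraph V E) : TopologicalSpace Γ.Point :=
  ⨆ e : E, TopologicalSpace.coinduced
    (fun t : Icc (0 : ℝ) (Γ.length e) => Γ.edgePath e t) inferInstance

/-- Piecewise `ℤ`-linear functions: continuous functions such that every edge can be cut at
finitely many points into segments on each of which the function is affine
with an integer slope. -/
def IsPLInt (Γ : MetricGraph V E) (f : Γ.Point → ℝ) : Prop :=
  Continuous f ∧ ∀ e, ∃ S : Finset ℝ, ∀ a b : ℝ, 0 ≤ a → a < b → b ≤ Γ.length e →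
    (∀ s ∈ S, s ∉ Ioo a b) →
      ∃ n : ℤ, ∀ t ∈ Icc a b, f (Γ.edgePath e t) = f (Γ.edgePath e a) + n * (t - a)

/-- The slope of `f` at the point with parameter `t` of the edge `e`, in the direction of the
head of `e`. -/
noncomputable def slopeForward (Γ : MetricGraph V E) (f : Γ.Point → ℝ) (e : E) (t : ℝ) : ℝ :=
  derivWithin (fun s => f (Γ.edgePath e s)) (Ici t) t

/-- The slope of `f` at the point with parameter `t` of the edge `e`, in the direction of the
tail of `e`. -/
noncomputable def slopeBackward (Γ : MetricGraph V E) (f : Γ.Point → ℝ) (e : E) (t : ℝ) : ℝ :=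
  -derivWithin (fun s => f (Γ.edgePath e s)) (Iic t) t

open Classical in
/-- The sum of the outgoing slopes of `f` at a point, over all tangent directions at the point
(a loop contributes two directions at its vertex). -/
noncomputable def outgoingSlopes [Fintype E] (Γ : MetricGraph V E) (f : Γ.Point → ℝ) :
    Γ.Point → ℝ
  | Point.vertex v =>
      (∑ e : E, if Γ.tail e = v then Γ.slopeForward f e 0 else 0) +
        ∑ e : E, if Γ.head e = v then Γ.slopeBackward f e (Γ.length e) else 0
  | Point.interior e t _ _ => Γ.slopeForward f e t + Γ.slopeBackward f e t

/-- The divisor group: the free abelian group on the points. -/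
abbrev Divisor (Γ : MetricGraph V E) : Type _ := Γ.Point →₀ ℤ

/-- `D` is the divisor of `f`: its coefficient at `x` is the sum of the incoming slopes
of `f` at `x`. -/
def IsDivisorOf [Fintype E] (Γ : MetricGraph V E) (f : Γ.Point → ℝ) (D : Γ.Divisor) : Prop :=
  ∀ x, (D x : ℝ) = -Γ.outgoingSlopes f x

theorem IsPLInt.differentiable_forward {Γ : MetricGraph V E} {f : Γ.Point → ℝ} (hf : Γ.IsPLInt f)
    (e : E) {t : ℝ} (h₀ : 0 ≤ t) (h₁ : t < Γ.length e) :
    DifferentiableWithinAt ℝ (fun s => f (Γ.edgePath e s)) (Ici t) t := by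
  obtain ⟨S, hS⟩ := hf.2 e
  let T := insert (Γ.length e) (S.filter (t < ·))
  have hT : T.Nonempty := Finset.insert_nonempty _ _
  have hb : t < T.min' hT := by
    rw [Finset.lt_min'_iff]
    intro y hy
    rcases Finset.mem_insert.1 hy with rfl | hy
    · exact h₁
    · exact (Finset.mem_filter.1 hy).2
  obtain ⟨n, hn⟩ := hS t (T.min' hT) h₀ hb (T.min'_le _ (Finset.mem_insert_self _ _)) (by
    intro s hs hst
    exact absurd (T.min'_le s (Finset.mem_insert_of_mem (Finset.mem_filter.2 ⟨hs, hst.1⟩)))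
      (not_le.2 hst.2))
  have hd : DifferentiableWithinAt ℝ (fun s => f (Γ.edgePath e t) + n * (s - t)) (Ici t) t := by
    fun_prop
  refine hd.congr_of_eventuallyEq ?_ (hn t ⟨le_rfl, hb.le⟩)
  filter_upwards [Icc_mem_nhdsGE hb] with s hs using hn s hs

theorem IsPLInt.differentiable_backward {Γ : MetricGraph V E} {f : Γ.Point → ℝ} (hf : Γ.IsPLInt f)
    (e : E) {t : ℝ} (h₀ : 0 < t) (h₁ : t ≤ Γ.length e) :
    DifferentiableWithinAt ℝ (fun s => f (Γ.edgePath e s)) (Iic t) t := by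
  obtain ⟨S, hS⟩ := hf.2 e
  let T := insert 0 (S.filter (· < t))
  have hT : T.Nonempty := Finset.insert_nonempty _ _
  have hb : T.max' hT < t := by
    rw [Finset.max'_lt_iff]
    intro y hy
    rcases Finset.mem_insert.1 hy with rfl | hy
    · exact h₀
    · exact (Finset.mem_filter.1 hy).2
  obtain ⟨n, hn⟩ := hS (T.max' hT) t (T.le_max' _ (Finset.mem_insert_self _ _)) hb h₁ (by
    intro s hs hst
    exact absurd (T.le_max' s (Finset.mem_insert_of_mem (Finset.mem_filter.2 ⟨hs, hst.2⟩)))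
      (not_le.2 hst.1))
  have hd : DifferentiableWithinAt ℝ
      (fun s => f (Γ.edgePath e (T.max' hT)) + n * (s - T.max' hT)) (Iic t) t := by
    fun_prop
  refine hd.congr_of_eventuallyEq ?_ (hn t ⟨hb.le, le_rfl⟩)
  filter_upwards [Icc_mem_nhdsLE hb] with s hs using hn s hs

theorem IsPLInt.zero (Γ : MetricGraph V E) : Γ.IsPLInt (fun _ => 0) :=
  ⟨continuous_const, fun _ => ⟨∅, fun _ _ _ _ _ _ => ⟨0, by simp⟩⟩⟩

theorem IsPLInt.neg {Γ : MetricGraph V E} {f : Γ.Point → ℝ} (hf : Γ.IsPLInt f) :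
    Γ.IsPLInt (fun x => -f x) := by
  refine ⟨hf.1.neg, fun e => ?_⟩
  obtain ⟨S, hS⟩ := hf.2 e
  refine ⟨S, fun a b h0 hab hb hd => ?_⟩
  obtain ⟨n, hn⟩ := hS a b h0 hab hb hd
  refine ⟨-n, fun t ht => ?_⟩
  beta_reduce
  rw [hn t ht]
  push_cast
  ring

theorem IsPLInt.add {Γ : MetricGraph V E} {f g : Γ.Point → ℝ} (hf : Γ.IsPLInt f)
    (hg : Γ.IsPLInt g) : Γ.IsPLInt (fun x => f x + g x) := by
  refine ⟨hf.1.add hg.1, fun e => ?_⟩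
  obtain ⟨S, hS⟩ := hf.2 e
  obtain ⟨T, hT⟩ := hg.2 e
  refine ⟨S ∪ T, fun a b h0 hab hb hd => ?_⟩
  obtain ⟨n, hn⟩ := hS a b h0 hab hb fun s hs => hd s (Finset.mem_union_left _ hs)
  obtain ⟨m, hm⟩ := hT a b h0 hab hb fun s hs => hd s (Finset.mem_union_right _ hs)
  refine ⟨n + m, fun t ht => ?_⟩
  beta_reduce
  rw [hn t ht, hm t ht]
  push_cast
  ring

theorem outgoingSlopes_zero [Fintype E] (Γ : MetricGraph V E) (x : Γ.Point) :
    Γ.outgoingSlopes (fun _ => 0) x = 0 := by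
  cases x <;> simp [outgoingSlopes, slopeForward, slopeBackward]

theorem outgoingSlopes_neg [Fintype E] (Γ : MetricGraph V E) (f : Γ.Point → ℝ) (x : Γ.Point) :
    Γ.outgoingSlopes (fun y => -f y) x = -Γ.outgoingSlopes f x := by
  have h1 : ∀ e t, Γ.slopeForward (fun y => -f y) e t = -Γ.slopeForward f e t := fun e t =>
    derivWithin.fun_neg
  have h2 : ∀ e t, Γ.slopeBackward (fun y => -f y) e t = -Γ.slopeBackward f e t := fun e t =>
    congrArg Neg.neg derivWithin.fun_neg
  cases x with
  | vertex v =>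
    simp only [outgoingSlopes, h1, h2, neg_add, ← Finset.sum_neg_distrib]
    congr 1 <;> refine Finset.sum_congr rfl fun e _ => ?_ <;> split_ifs <;> simp
  | interior e t _ _ =>
    simp only [outgoingSlopes, h1, h2, neg_add]

theorem outgoingSlopes_add [Fintype E] {Γ : MetricGraph V E} {f g : Γ.Point → ℝ}
    (hf : Γ.IsPLInt f) (hg : Γ.IsPLInt g) (x : Γ.Point) :
    Γ.outgoingSlopes (fun y => f y + g y) x = Γ.outgoingSlopes f x + Γ.outgoingSlopes g x := by
  have h1 : ∀ e t, 0 ≤ t → t < Γ.length e →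
      Γ.slopeForward (fun y => f y + g y) e t = Γ.slopeForward f e t + Γ.slopeForward g e t :=
    fun e t h₀ h₁ => derivWithin_fun_add (hf.differentiable_forward e h₀ h₁)
      (hg.differentiable_forward e h₀ h₁)
  have h2 : ∀ e t, 0 < t → t ≤ Γ.length e →
      Γ.slopeBackward (fun y => f y + g y) e t = Γ.slopeBackward f e t + Γ.slopeBackward g e t := by
    intro e t h₀ h₁
    rw [slopeBackward, derivWithin_fun_add (hf.differentiable_backward e h₀ h₁)
      (hg.differentiable_backward e h₀ h₁), neg_add]
    rfl
  cases x with
  | vertex v =>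
    simp only [outgoingSlopes]
    rw [add_add_add_comm]
    refine congrArg₂ (· + ·) ?_ ?_ <;>
      refine Eq.trans ?_ Finset.sum_add_distrib <;> refine Finset.sum_congr rfl fun e _ => ?_ <;> split_ifs
    · exact h1 e 0 le_rfl (Γ.length_pos e)
    · simp
    · exact h2 e _ (Γ.length_pos e) le_rfl
    · simp
  | interior e t h₀ h₁ =>
    simp only [outgoingSlopes]
    rw [h1 e t h₀.le h₁, h2 e t h₀ h₁.le]
    ring

/-- The group of principal divisors, the image of the Laplacian on the piecewise `ℤ`-linear
functions. -/
noncomputable def principal [Fintype E] (Γ : MetricGraph V E) : AddSubgroup Γ.Divisor where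
  carrier := {D | ∃ f, Γ.IsPLInt f ∧ Γ.IsDivisorOf f D}
  zero_mem' := ⟨_, IsPLInt.zero Γ, fun x => by simp [outgoingSlopes_zero]⟩
  add_mem' := by
    rintro D D' ⟨f, hf, hD⟩ ⟨g, hg, hD'⟩
    refine ⟨_, hf.add hg, fun x => ?_⟩
    rw [outgoingSlopes_add hf hg, Finsupp.add_apply, Int.cast_add, hD x, hD' x, neg_add]
  neg_mem' := by
    rintro D ⟨f, hf, hD⟩
    refine ⟨_, hf.neg, fun x => ?_⟩
    rw [outgoingSlopes_neg, Finsupp.neg_apply, Int.cast_neg, hD x]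

/-- The Picard group: divisors modulo linear equivalence. -/
abbrev Pic [Fintype E] (Γ : MetricGraph V E) : Type _ := Γ.Divisor ⧸ Γ.principal

/-- The class `[D]` of a divisor. -/
noncomputable def divisorClass [Fintype E] (Γ : MetricGraph V E) (D : Γ.Divisor) : Γ.Pic :=
  QuotientAddGroup.mk' Γ.principal D

/-- The class `[x]` of a point. -/
noncomputable def pointClass [Fintype E] (Γ : MetricGraph V E) (x : Γ.Point) : Γ.Pic :=
  Γ.divisorClass (Finsupp.single x 1)

/-- The degree of a divisor. -/
noncomputable def degree (Γ : MetricGraph V E) : Γ.Divisor →+ ℤ :=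
  Finsupp.degree

/-- The Jacobian: the group of divisor classes of degree zero, a subgroup of `Pic`. -/
noncomputable def Jac [Fintype E] (Γ : MetricGraph V E) : AddSubgroup Γ.Pic :=
  Γ.degree.ker.map (QuotientAddGroup.mk' Γ.principal)

/-- The Abel--Jacobi map `x ↦ [x - q]` with basepoint `q`. -/
noncomputable def abelJacobi [Fintype E] (Γ : MetricGraph V E) (q x : Γ.Point) : Γ.Jac :=
  ⟨Γ.divisorClass (Finsupp.single x 1 - Finsupp.single q 1),
    AddSubgroup.mem_map_of_mem _ (by
      rw [AddMonoidHom.mem_ker, map_sub]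
      simp [degree])⟩

/-- The Manin--Mumford condition: for every basepoint, the image of the Abel--Jacobi map meets
only finitely many torsion points of the Jacobian. -/
def ManinMumford [Fintype E] (Γ : MetricGraph V E) : Prop :=
  ∀ q : Γ.Point, (range (Γ.abelJacobi q) ∩ {c : Γ.Jac | IsOfFinAddOrder c}).Finite

/-- The effective divisor classes of degree `d`. -/
def Eff [Fintype E] (Γ : MetricGraph V E) (d : ℤ) : Set Γ.Pic :=
  {c | ∃ D : Γ.Divisor, (∀ x, 0 ≤ D x) ∧ Γ.degree D = d ∧ c = Γ.divisorClass D}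

/-- The degree `d` torsion packet of a class `c`: the effective classes `c'` of degree `d` such
that `c' - c` is a torsion point of the Jacobian. -/
def torsionPacket [Fintype E] (Γ : MetricGraph V E) (d : ℤ) (c : Γ.Pic) : Set Γ.Pic :=
  {c' ∈ Γ.Eff d | ∃ j : Γ.Jac, IsOfFinAddOrder j ∧ c' - c = j}

/-- If all numbers `m * ℓ e` are integers, these are the vertices of the model of `Γ` that is
obtained by subdividing every edge into segments of length `1 / m`. -/
def subdivisionVertices (Γ : MetricGraph V E) (m : ℕ) : Set Γ.Point :=
  range Point.vertex ∪ {x | ∃ e, ∃ j : ℕ, (j : ℝ) / m ≤ Γ.length e ∧ x = Γ.edgePath e (j / m)}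

end MetricGraph

/-! With rational edge lengths, points at rational parameters all differ by torsion, and infinitely
many of them stay distinct in `Pic`. Torsion: the Laplacian with weights `1 / ℓ e` is defined over
`ℚ`, and by connectedness its range contains every difference of two vertices. Clearing denominators
in a rational solution gives an affine function with integer slopes, so a multiple of `v - w` is
principal (`isOfFinAddOrder_vertex_sub`). A tent function reduces a rational interior point to the
ends of its edge (`isOfFinAddOrder_edgePath_sub`). Infinitude: genus at least one yields a nonzero
rational circulation `z`. Pairing a divisor with `z` through positions along edges, and scaling by a
suitable `M`, gives an integer on each principal divisor (`exists_int_sum_eq`). This is a tropical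
period pairing, with values modulo `ℤ`. On points of one edge with `z e ≠ 0` it is the position
times `M * z e`, so it separates points sufficiently close to the tail. -/

namespace MetricGraph

open Filter Topology

variable {V E : Type*}

/-! ### One-sided slopes -/

section Slopes

variable {Γ : MetricGraph V E} {f : Γ.Point → ℝ} {e : E} {t k : ℝ}

theorem slopeForward_eq
    (h : ∀ᶠ s in 𝓝[≥] t, f (Γ.edgePath e s) = f (Γ.edgePath e t) + k * (s - t)) :
    Γ.slopeForward f e t = k := by
  have hd : HasDerivWithinAt (fun s => f (Γ.edgePath e t) + k * (s - t)) k (Ici t) t := by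
    simpa using (((hasDerivWithinAt_id t (Ici t)).sub_const t).const_mul k).const_add
      (f (Γ.edgePath e t))
  exact (hd.congr_of_eventuallyEq h (by simp)).derivWithin (uniqueDiffWithinAt_Ici t)

theorem slopeBackward_eq
    (h : ∀ᶠ s in 𝓝[≤] t, f (Γ.edgePath e s) = f (Γ.edgePath e t) + k * (s - t)) :
    Γ.slopeBackward f e t = -k := by
  have hd : HasDerivWithinAt (fun s => f (Γ.edgePath e t) + k * (s - t)) k (Iic t) t := by
    simpa using (((hasDerivWithinAt_id t (Iic t)).sub_const t).const_mul k).const_add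
      (f (Γ.edgePath e t))
  rw [slopeBackward, (hd.congr_of_eventuallyEq h (by simp)).derivWithin (uniqueDiffWithinAt_Iic t)]

theorem slopeForward_eq_of_Icc {a b c : ℝ} (h : ∀ s ∈ Icc a b, f (Γ.edgePath e s) = c + k * s)
    (hat : a ≤ t) (htb : t < b) : Γ.slopeForward f e t = k := by
  refine slopeForward_eq ?_
  filter_upwards [Icc_mem_nhdsGE htb] with s hs
  rw [h s ⟨hat.trans hs.1, hs.2⟩, h t ⟨hat, htb.le⟩]
  ring

theorem slopeBackward_eq_of_Icc {a b c : ℝ} (h : ∀ s ∈ Icc a b, f (Γ.edgePath e s) = c + k * s)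
    (hat : a < t) (htb : t ≤ b) : Γ.slopeBackward f e t = -k := by
  refine slopeBackward_eq ?_
  filter_upwards [Icc_mem_nhdsLE hat] with s hs
  rw [h s ⟨hs.1, hs.2.trans htb⟩, h t ⟨hat.le, htb⟩]
  ring

theorem IsPLInt.eventually_right (hf : Γ.IsPLInt f) (e : E) (h₀ : 0 ≤ t)
    (h₁ : t < Γ.length e) :
    ∃ n : ℤ, ∀ᶠ s in 𝓝[≥] t, f (Γ.edgePath e s) = f (Γ.edgePath e t) + n * (s - t) := by
  obtain ⟨S, hS⟩ := hf.2 e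
  -- The minimum of `T` is the next breakpoint after `t`; including the end of the edge makes `T`
  -- nonempty and keeps that minimum on the edge.
  let T := insert (Γ.length e) (S.filter (t < ·))
  have hT : T.Nonempty := Finset.insert_nonempty _ _
  have hb : t < T.min' hT := by
    rw [Finset.lt_min'_iff]
    intro y hy
    rcases Finset.mem_insert.1 hy with rfl | hy
    · exact h₁
    · exact (Finset.mem_filter.1 hy).2
  obtain ⟨n, hn⟩ := hS t (T.min' hT) h₀ hb (T.min'_le _ (Finset.mem_insert_self _ _)) (by
    intro s hs hst
    exact absurd (T.min'_le s (Finset.mem_insert_of_mem (Finset.mem_filter.2 ⟨hs, hst.1⟩)))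
      (not_le.2 hst.2))
  refine ⟨n, ?_⟩
  filter_upwards [Icc_mem_nhdsGE hb] with s hs using hn s hs

theorem IsPLInt.eventually_left (hf : Γ.IsPLInt f) (e : E) (h₀ : 0 < t)
    (h₁ : t ≤ Γ.length e) :
    ∃ n : ℤ, ∀ᶠ s in 𝓝[≤] t, f (Γ.edgePath e s) = f (Γ.edgePath e t) + n * (s - t) := by
  obtain ⟨S, hS⟩ := hf.2 e
  let T := insert 0 (S.filter (· < t))
  have hT : T.Nonempty := Finset.insert_nonempty _ _
  have hb : T.max' hT < t := by
    rw [Finset.max'_lt_iff]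
    intro y hy
    rcases Finset.mem_insert.1 hy with rfl | hy
    · exact h₀
    · exact (Finset.mem_filter.1 hy).2
  obtain ⟨n, hn⟩ := hS (T.max' hT) t (T.le_max' _ (Finset.mem_insert_self _ _)) hb h₁ (by
    intro s hs hst
    exact absurd (T.le_max' s (Finset.mem_insert_of_mem (Finset.mem_filter.2 ⟨hs, hst.2⟩)))
      (not_le.2 hst.1))
  refine ⟨n, ?_⟩
  filter_upwards [Icc_mem_nhdsLE hb] with s hs
  rw [hn s hs, hn t ⟨hb.le, le_rfl⟩]
  ring

end Slopes

/-! ### Functions on the glued space -/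

section Points

variable {Γ : MetricGraph V E}

theorem edgePath_zero (e : E) : Γ.edgePath e 0 = Point.vertex (Γ.tail e) := by
  simp [edgePath]

theorem edgePath_length (e : E) : Γ.edgePath e (Γ.length e) = Point.vertex (Γ.head e) := by
  simp [edgePath, Γ.length_pos e]

theorem edgePath_of_mem_Ioo (e : E) {t : ℝ} (h₀ : 0 < t) (h₁ : t < Γ.length e) :
    Γ.edgePath e t = Point.interior e t h₀ h₁ := by
  simp [edgePath, h₀, h₁]

/-- Universal property of the quotient topology. -/
theorem continuous_iff_edgePath {X : Type*} [TopologicalSpace X] {f : Γ.Point → X} :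
    Continuous f ↔ ∀ e, ContinuousOn (fun t => f (Γ.edgePath e t)) (Icc 0 (Γ.length e)) := by
  simp only [continuous_iSup_dom, continuous_coinduced_dom, continuousOn_iff_continuous_domRestrict]
  rfl

/-- The function with values `g` at the vertices and `φ e` along the edge `e`. -/
def glue (Γ : MetricGraph V E) (g : V → ℝ) (φ : E → ℝ → ℝ) : Γ.Point → ℝ
  | Point.vertex v => g v
  | Point.interior e t _ _ => φ e t

theorem glue_edgePath {g : V → ℝ} {φ : E → ℝ → ℝ} {e : E} (h₀ : φ e 0 = g (Γ.tail e))
    (h₁ : φ e (Γ.length e) = g (Γ.head e)) {t : ℝ} (ht : t ∈ Icc 0 (Γ.length e)) :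
    Γ.glue g φ (Γ.edgePath e t) = φ e t := by
  rcases ht.1.eq_or_lt with rfl | h
  · rw [edgePath_zero, h₀, glue]
  rcases ht.2.eq_or_lt with rfl | h'
  · rw [edgePath_length, h₁, glue]
  rw [edgePath_of_mem_Ioo e h h', glue]

theorem divisorClass_eq_zero_iff [Fintype E] {D : Γ.Divisor} :
    Γ.divisorClass D = 0 ↔ D ∈ Γ.principal :=
  QuotientAddGroup.eq_zero_iff D

end Points

theorem exists_common_denominator {ι : Type*} [Fintype ι] (q : ι → ℚ) :
    ∃ N : ℕ, 0 < N ∧ ∀ i, ∃ z : ℤ, (N : ℚ) * q i = z := by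
  refine ⟨∏ i, (q i).den, Finset.prod_pos fun i _ => (q i).den_pos, fun i => ?_⟩
  obtain ⟨k, hk⟩ := Finset.dvd_prod_of_mem (fun i => (q i).den) (Finset.mem_univ i)
  refine ⟨k * (q i).num, ?_⟩
  rw [hk]
  push_cast
  linear_combination (k : ℚ) * Rat.mul_den_eq_num (q i)

theorem eq_of_forall_tail_eq_head (Γ : MetricGraph V E) {α : Type*} {φ : V → α}
    (h : ∀ e, φ (Γ.tail e) = φ (Γ.head e)) (v w : V) : φ v = φ w := by
  induction Γ.connected v w with
  | rel a b hab => obtain ⟨e, rfl, rfl⟩ := hab; exact h e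
  | refl => rfl
  | symm _ _ _ ih => exact ih.symm
  | trans _ _ _ _ _ ih ih' => exact ih.trans ih'

/-! ### The weighted graph Laplacian -/

section Laplacian

variable [Fintype E] (Γ : MetricGraph V E)

open Classical in
/-- The flow at every vertex of the 1-chain `z`: what leaves the vertex minus what enters it. -/
noncomputable def divergence {R : Type*} [CommRing R] : (E → R) →ₗ[R] (V → R) where
  toFun z v := (∑ e, if Γ.tail e = v then z e else 0) + ∑ e, if Γ.head e = v then -z e else 0
  map_add' z z' := by
    ext v
    simp only [Pi.add_apply]
    rw [add_add_add_comm]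
    refine congrArg₂ (· + ·) ?_ ?_ <;> refine Eq.trans ?_ Finset.sum_add_distrib <;> refine Finset.sum_congr rfl fun e _ => ?_ <;> split_ifs <;> ring
  map_smul' r z := by
    ext v
    simp only [Pi.smul_apply, smul_eq_mul, RingHom.id_apply, mul_add, Finset.mul_sum]
    congr 1 <;> refine Finset.sum_congr rfl fun e _ => ?_ <;> split_ifs <;> ring

/-- Summation by parts: each edge contributes once at its tail and once, with the opposite sign, at
its head. For a loop the two cancel. -/
theorem sum_mul_divergence [Fintype V] {R : Type*} [CommRing R] (z : E → R) (φ : V → R) :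
    ∑ v, φ v * Γ.divergence z v = ∑ e, z e * (φ (Γ.tail e) - φ (Γ.head e)) := by
  classical
  simp only [divergence, LinearMap.coe_mk, AddHom.coe_mk, mul_add, Finset.mul_sum,
    Finset.sum_add_distrib]
  rw [Finset.sum_comm, Finset.sum_comm (γ := V) (s := Finset.univ) (t := Finset.univ)
    (f := fun v e => φ v * if Γ.head e = v then -z e else 0), ← Finset.sum_add_distrib]
  refine Finset.sum_congr rfl fun e _ => ?_
  simp only [mul_ite, mul_zero, Finset.sum_ite_eq, Finset.mem_univ, if_true]
  ring

/-- The Laplacian of the graph with edge weights `c`. -/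
noncomputable def laplacian {R : Type*} [CommRing R] (c : E → R) : (V → R) →ₗ[R] (V → R) :=
  Γ.divergence ∘ₗ
    { toFun := fun g e => c e * (g (Γ.head e) - g (Γ.tail e))
      map_add' := fun g g' => by ext e; simp only [Pi.add_apply]; ring
      map_smul' := fun r g => by
        ext e; simp only [Pi.smul_apply, smul_eq_mul, RingHom.id_apply]; ring }

theorem laplacian_apply {R : Type*} [CommRing R] (c : E → R) (g : V → R) :
    Γ.laplacian c g = Γ.divergence fun e => c e * (g (Γ.head e) - g (Γ.tail e)) := rfl

open Classical in
-- By duality: a functional that kills the range has coefficients of zero Dirichlet energy, hence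
-- constant by connectedness, so it also kills the right-hand side. Working over `ℚ` is what later
-- permits clearing denominators.
theorem exists_laplacian_eq [Fintype V] {c : E → ℚ} (hc : ∀ e, 0 < c e) (v w : V) :
    ∃ g : V → ℚ, Γ.laplacian c g = Pi.single v 1 - Pi.single w 1 := by
  by_contra hn
  obtain ⟨F, hF, hker⟩ := Submodule.exists_le_ker_of_notMem
    (K := ℚ) (p := LinearMap.range (Γ.laplacian c)) (v := Pi.single v 1 - Pi.single w 1)
    (fun h => hn (LinearMap.mem_range.1 h))
  set φ : V → ℚ := fun u => F (Pi.single u 1) with hφ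
  have hFφ : ∀ g : V → ℚ, F g = ∑ u, φ u * g u := fun g => by
    rw [LinearMap.pi_apply_eq_sum_univ F g]
    refine Finset.sum_congr rfl fun u _ => ?_
    rw [hφ, smul_eq_mul, mul_comm]
    congr 2
    ext j
    simp [Pi.single_apply, eq_comm]
  -- Evaluating `F` on the Laplacian of its own coefficient vector produces minus the energy of `φ`.
  have h0 : F (Γ.laplacian c φ) = 0 := hker ⟨φ, rfl⟩
  rw [hFφ, laplacian_apply, sum_mul_divergence] at h0
  have h1 : ∑ e, c e * (φ (Γ.tail e) - φ (Γ.head e)) ^ 2 = 0 := by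
    rw [← neg_eq_zero, ← h0, ← Finset.sum_neg_distrib]
    exact Finset.sum_congr rfl fun e _ => by ring
  rw [Finset.sum_eq_zero_iff_of_nonneg
    (fun e _ => mul_nonneg (hc e).le (sq_nonneg _))] at h1
  have h2 := Γ.eq_of_forall_tail_eq_head (φ := φ) (fun e => by
    have := h1 e (Finset.mem_univ e)
    simpa [(hc e).ne', sub_eq_zero] using this) v w
  rw [map_sub] at hF
  exact hF (sub_eq_zero.2 h2)

theorem map_divergence {R S : Type*} [CommRing R] [CommRing S] (F : R →+* S) (z : E → R) (v : V) :
    F (Γ.divergence z v) = Γ.divergence (fun e => F (z e)) v := by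
  simp only [divergence, LinearMap.coe_mk, AddHom.coe_mk, map_add, map_sum, apply_ite F, map_neg,
    map_zero]

end Laplacian

/-! ### Rational points differ by torsion -/

section Torsion

variable [Fintype E] {Γ : MetricGraph V E}

/-- The divisor of the function that is affine along every edge. -/
theorem principal_of_affine {g : V → ℝ} {z : E → ℤ}
    (h : ∀ e, g (Γ.head e) = g (Γ.tail e) + z e * Γ.length e) {D : Γ.Divisor}
    (hv : ∀ v, D (Point.vertex v) = -Γ.divergence z v)
    (hi : ∀ e t h₀ h₁, D (Point.interior e t h₀ h₁) = 0) : D ∈ Γ.principal := by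
  set f := Γ.glue g fun e t => g (Γ.tail e) + z e * t with hf
  have hφ : ∀ e, ∀ t ∈ Icc 0 (Γ.length e),
      f (Γ.edgePath e t) = g (Γ.tail e) + z e * t := fun e t ht =>
    glue_edgePath (φ := fun e t => g (Γ.tail e) + z e * t) (by simp) (h e).symm ht
  refine ⟨f, ⟨continuous_iff_edgePath.2 fun e => ?_, fun e => ⟨∅, fun a b ha hab hb _ =>
    ⟨z e, fun t ht => ?_⟩⟩⟩, fun x => ?_⟩
  · exact ContinuousOn.congr (by fun_prop) (hφ e)
  · rw [hφ e t ⟨ha.trans ht.1, ht.2.trans hb⟩, hφ e a ⟨ha, hab.le.trans hb⟩]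
    ring
  · cases x with
    | vertex v =>
      rw [hv, outgoingSlopes]
      push_cast
      rw [← eq_intCast (Int.castRingHom ℝ) (Γ.divergence z v), map_divergence]
      simp only [eq_intCast, slopeForward_eq_of_Icc (hφ _) le_rfl (Γ.length_pos _),
        slopeBackward_eq_of_Icc (hφ _) (Γ.length_pos _) le_rfl]
      rfl
    | interior e t h₀ h₁ =>
      rw [hi, outgoingSlopes, slopeForward_eq_of_Icc (hφ e) h₀.le h₁,
        slopeBackward_eq_of_Icc (hφ e) h₀ h₁.le]
      simp

theorem isOfFinAddOrder_vertex_sub [Fintype V] (hrat : ∀ e, ∃ r : ℚ, Γ.length e = r) (v w : V) :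
    IsOfFinAddOrder (Γ.pointClass (Point.vertex v) - Γ.pointClass (Point.vertex w)) := by
  classical
  choose r hr using hrat
  have hr0 : ∀ e, 0 < r e := fun e => by
    have := Γ.length_pos e
    rw [hr] at this
    exact_mod_cast this
  -- The weights `1 / r e` turn differences of values into slopes. The order `w v` is reversed
  -- because divisors count incoming slopes, while `divergence` counts outgoing ones.
  obtain ⟨g, hg⟩ := Γ.exists_laplacian_eq (c := fun e => (r e)⁻¹) (fun e => inv_pos.2 (hr0 e)) w v
  obtain ⟨N, hN, hz⟩ := exists_common_denominator
    fun e => (r e)⁻¹ * (g (Γ.head e) - g (Γ.tail e))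
  choose z hz using hz
  have hdiv : ∀ u, Γ.divergence z u = N * ((Pi.single w 1 - Pi.single v 1 : V → ℤ) u) := by
    intro u
    have h1 := congrFun hg u
    rw [laplacian_apply] at h1
    have h2 : (fun e => (z e : ℚ)) =
        (N : ℚ) • fun e => (r e)⁻¹ * (g (Γ.head e) - g (Γ.tail e)) := by
      ext e; rw [← hz e]; rfl
    have h3 : ((Γ.divergence z u : ℤ) : ℚ) = N * ((Pi.single w 1 - Pi.single v 1 : V → ℚ) u) := by
      rw [← eq_intCast (Int.castRingHom ℚ), map_divergence]
      simp only [eq_intCast]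
      rw [h2, map_smul, Pi.smul_apply, h1, smul_eq_mul]
    rw [← Int.cast_inj (α := ℚ), h3]
    simp [Pi.single_apply]
  refine isOfFinAddOrder_iff_nsmul_eq_zero.2 ⟨N, hN, ?_⟩
  have key : N • (Finsupp.single (Point.vertex v) 1 - Finsupp.single (Point.vertex w) 1 :
      Γ.Divisor) ∈ Γ.principal := by
    refine principal_of_affine (g := fun u => ((N * g u : ℚ) : ℝ)) (z := z) (fun e => ?_)
      (fun u => ?_) fun e t h₀ h₁ => ?_
    · have h1 : (N * g (Γ.head e) : ℚ) = N * g (Γ.tail e) + z e * r e := by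
        rw [← hz e]
        field_simp [(hr0 e).ne']
        ring
      rw [hr e]
      exact_mod_cast h1
    · rw [hdiv u]
      simp only [Finsupp.smul_apply, Finsupp.sub_apply, Finsupp.single_apply, Pi.sub_apply,
        Pi.single_apply, Point.vertex.injEq, nsmul_eq_mul, eq_comm (a := u)]
      ring
    · simp
  exact divisorClass_eq_zero_iff.2 key

/-- A tent over the edge `e` with its peak at the distance `t` from the tail of `e`. -/
theorem principal_of_tent {e : E} {t : ℝ} (h₀ : 0 < t) (h₁ : t < Γ.length e) {a b : ℕ}
    (hab : a * t = b * (Γ.length e - t)) :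
    ((a + b) • Finsupp.single (Point.interior e t h₀ h₁) 1
      - a • Finsupp.single (Point.vertex (Γ.tail e)) 1
      - b • Finsupp.single (Point.vertex (Γ.head e)) 1 : Γ.Divisor) ∈ Γ.principal := by
  classical
  -- Slope `a` up to the peak and `-b` after it; `hab` says that the two pieces meet at `t`.
  set φ : E → ℝ → ℝ := fun e' s =>
    if e' = e then (if s ≤ t then a * s else b * (Γ.length e - s)) else 0 with hφ
  set f := Γ.glue 0 φ with hf
  have hval : ∀ e', ∀ s ∈ Icc 0 (Γ.length e'), f (Γ.edgePath e' s) = φ e' s := by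
    intro e' s hs
    refine glue_edgePath ?_ ?_ hs
    · by_cases h : e' = e <;> simp [hφ, h, h₀.le]
    · by_cases h : e' = e
      · subst h; simp [hφ, h₁]
      · simp [hφ, h]
  have hother : ∀ e', e' ≠ e → ∀ s ∈ Icc 0 (Γ.length e'),
      f (Γ.edgePath e' s) = 0 + 0 * s := by
    intro e' he s hs
    rw [hval e' s hs]
    simp [hφ, he]
  have hleft : ∀ s ∈ Icc 0 t, f (Γ.edgePath e s) = 0 + a * s := by
    intro s hs
    rw [hval e s ⟨hs.1, hs.2.trans h₁.le⟩]
    simp [hφ, hs.2]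
  have hright : ∀ s ∈ Icc t (Γ.length e),
      f (Γ.edgePath e s) = b * Γ.length e + (-b) * s := by
    intro s hs
    rw [hval e s ⟨h₀.le.trans hs.1, hs.2⟩]
    rcases hs.1.eq_or_lt with rfl | h
    · simp [hφ]; linarith
    · simp [hφ, not_le.2 h]; ring
  have hF0 : ∀ e', Γ.slopeForward f e' 0 = if e' = e then (a : ℝ) else 0 := by
    intro e'
    split_ifs with h
    · subst h; exact slopeForward_eq_of_Icc hleft le_rfl h₀
    · exact slopeForward_eq_of_Icc (hother e' h) le_rfl (Γ.length_pos e')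
  have hB1 : ∀ e', Γ.slopeBackward f e' (Γ.length e') = if e' = e then (b : ℝ) else 0 := by
    intro e'
    split_ifs with h
    · subst h; rw [slopeBackward_eq_of_Icc hright h₁ le_rfl, neg_neg]
    · rw [slopeBackward_eq_of_Icc (hother e' h) (Γ.length_pos e') le_rfl, neg_zero]
  refine ⟨f, ⟨continuous_iff_edgePath.2 fun e' => ?_, fun e' => ⟨{t}, fun p q hp hpq hq hS => ?_⟩⟩,
    fun x => ?_⟩
  · by_cases h : e' = e
    · subst h
      rw [← Icc_union_Icc_eq_Icc h₀.le h₁.le]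
      exact ContinuousOn.union_of_isClosed (ContinuousOn.congr (by fun_prop) hleft)
        (ContinuousOn.congr (by fun_prop) hright) isClosed_Icc isClosed_Icc
    · exact ContinuousOn.congr (by fun_prop) (hother e' h)
  · by_cases h : e' = e
    · subst h
      have hS := hS t (Finset.mem_singleton_self t)
      rcases le_or_gt q t with hqt | hqt
      · refine ⟨a, fun s hs => ?_⟩
        rw [hleft s ⟨hp.trans hs.1, hs.2.trans hqt⟩, hleft p ⟨hp, hpq.le.trans hqt⟩]
        push_cast; ring
      · have htp : t ≤ p := by
          by_contra hc
          exact hS ⟨not_le.1 hc, hqt⟩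
        refine ⟨-b, fun s hs => ?_⟩
        rw [hright s ⟨htp.trans hs.1, hs.2.trans hq⟩, hright p ⟨htp, hpq.le.trans hq⟩]
        push_cast; ring
    · refine ⟨0, fun s hs => ?_⟩
      rw [hother e' h s ⟨hp.trans hs.1, hs.2.trans hq⟩, hother e' h p ⟨hp, hpq.le.trans hq⟩]
      simp
  · cases x with
    | vertex v =>
      rw [outgoingSlopes]
      simp only [hF0, hB1]
      have hs : ∀ (x : E → V) (c : ℝ), (∑ e', if x e' = v then (if e' = e then c else 0) else 0) =
          if x e = v then c else 0 := by
        intro x c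
        rw [Finset.sum_eq_single e (fun e' _ he => by simp [he]) (by simp)]
        simp
      rw [hs, hs]
      simp only [Finsupp.sub_apply, Finsupp.smul_apply, Finsupp.single_apply, reduceCtorEq,
        if_false, Point.vertex.injEq, smul_ite, smul_zero, nsmul_eq_mul, mul_one]
      push_cast
      ring
    | interior e' s hs₀ hs₁ =>
      rw [outgoingSlopes]
      simp only [Finsupp.sub_apply, Finsupp.smul_apply, Finsupp.single_apply, reduceCtorEq,
        if_false, Point.interior.injEq, smul_ite, smul_zero, nsmul_eq_mul, mul_one, sub_zero]
      by_cases h : e' = e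
      · subst h
        rcases lt_trichotomy s t with h | rfl | h
        · rw [slopeForward_eq_of_Icc hleft hs₀.le h, slopeBackward_eq_of_Icc hleft hs₀ h.le]
          simp [h.ne']
        · rw [slopeForward_eq_of_Icc hright le_rfl hs₁, slopeBackward_eq_of_Icc hleft hs₀ le_rfl]
          simp
        · rw [slopeForward_eq_of_Icc hright h.le hs₁, slopeBackward_eq_of_Icc hright h hs₁.le]
          simp [h.ne]
      · rw [slopeForward_eq_of_Icc (hother e' h) hs₀.le hs₁,
          slopeBackward_eq_of_Icc (hother e' h) hs₀ hs₁.le]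
        simp [Ne.symm h]

/-- The tent makes a positive multiple of an interior point equivalent to a combination of the two
ends of its edge with the same total degree, so the vertex case applies. Parameters outside the open
edge give vertices directly. -/
theorem isOfFinAddOrder_edgePath_sub [Fintype V] (hrat : ∀ e, ∃ r : ℚ, Γ.length e = r) (e : E) (q : ℚ)
    (v : V) :
    IsOfFinAddOrder (Γ.pointClass (Γ.edgePath e q) - Γ.pointClass (Point.vertex v)) := by
  by_cases h₀ : 0 < (q : ℝ)
  swap
  · simpa [edgePath, h₀] using isOfFinAddOrder_vertex_sub hrat _ v
  by_cases h₁ : (q : ℝ) < Γ.length e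
  swap
  · simpa [edgePath, h₀, h₁] using isOfFinAddOrder_vertex_sub hrat _ v
  rw [edgePath_of_mem_Ioo e h₀ h₁]
  obtain ⟨r, hr⟩ := hrat e
  have hq : 0 < q := by exact_mod_cast h₀
  have hqr : 0 < r - q := by rw [hr] at h₁; exact sub_pos.2 (by exact_mod_cast h₁)
  -- The ratio in which the point divides the edge; its denominator and numerator are the integer
  -- slopes of a tent that peaks there.
  set p := q / (r - q) with hp
  have hpp : 0 < p := div_pos hq hqr
  have hab : (p.den : ℚ) * q = p.num.toNat * (r - q) := by
    have h1 : ((p.num.toNat : ℤ) : ℚ) = p.den * p := by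
      rw [Int.toNat_of_nonneg (Rat.num_nonneg.2 hpp.le), mul_comm, Rat.mul_den_eq_num]
    rw [Int.cast_natCast] at h1
    rw [h1, hp, mul_assoc, div_mul_cancel₀ _ hqr.ne']
  have key := principal_of_tent (a := p.den) (b := p.num.toNat) h₀ h₁
    (by rw [hr]; exact_mod_cast hab)
  rw [← divisorClass_eq_zero_iff] at key
  simp only [divisorClass, map_sub, map_nsmul] at key
  change (p.den + p.num.toNat) • Γ.pointClass (Point.interior e q h₀ h₁)
    - p.den • Γ.pointClass (Point.vertex (Γ.tail e))
    - p.num.toNat • Γ.pointClass (Point.vertex (Γ.head e)) = 0 at key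
  have h2 : (p.den + p.num.toNat) •
      (Γ.pointClass (Point.interior e q h₀ h₁) - Γ.pointClass (Point.vertex v)) =
      p.den • (Γ.pointClass (Point.vertex (Γ.tail e)) - Γ.pointClass (Point.vertex v)) +
      p.num.toNat • (Γ.pointClass (Point.vertex (Γ.head e)) - Γ.pointClass (Point.vertex v)) := by
    rw [← sub_eq_zero, ← key]
    module
  refine IsOfFinAddOrder.of_nsmul (n := p.den + p.num.toNat) ?_
    (by have := p.den_pos; omega)
  rw [h2]
  exact ((isOfFinAddOrder_vertex_sub hrat _ v).nsmul).add (isOfFinAddOrder_vertex_sub hrat _ v).nsmul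

end Torsion

/-! ### Positions of a principal divisor along one edge -/

/-- The derivative is locally constant on the connected open interval, hence constant. The germ at
`0` identifies it as `k₀`, and continuity carries the formula to the endpoint `L`. -/
theorem eq_affine_of_eventually_affine {h : ℝ → ℝ} {L k₀ : ℝ} (hL : 0 < L)
    (hc : ContinuousOn h (Icc 0 L)) (h0 : ∀ᶠ s in 𝓝[≥] 0, h s = h 0 + k₀ * (s - 0))
    (hloc : ∀ t ∈ Ioo 0 L, ∃ k, ∀ᶠ s in 𝓝 t, h s = h t + k * (s - t)) :
    h L = h 0 + k₀ * L := by
  have haff : ∀ c k t x : ℝ, HasDerivAt (fun s => c + k * (s - t)) k x := fun c k t x => by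
    simpa using (((hasDerivAt_id x).sub_const t).const_mul k).const_add c
  have hd : ∀ t ∈ Ioo 0 L, ∃ k, ∀ᶠ s in 𝓝 t, HasDerivAt h k s := by
    intro t ht
    obtain ⟨k, hk⟩ := hloc t ht
    exact ⟨k, hk.eventually_nhds.mono fun s hs => (haff _ _ _ _).congr_of_eventuallyEq hs⟩
  have hdd : ∀ t ∈ Ioo 0 L, HasDerivAt (deriv h) 0 t := by
    intro t ht
    obtain ⟨k, hk⟩ := hd t ht
    exact (hasDerivAt_const t k).congr_of_eventuallyEq (hk.mono fun s hs => hs.deriv)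
  obtain ⟨n, hn⟩ := isOpen_Ioo.exists_is_const_of_deriv_eq_zero isPreconnected_Ioo
    (fun t ht => (hdd t ht).differentiableAt.differentiableWithinAt) (fun t ht => (hdd t ht).deriv)
  obtain ⟨ε, hε, hεs⟩ := (mem_nhdsGE_iff_exists_Ico_subset (a := (0 : ℝ))).1 h0
  have hm : 0 < min ε L := lt_min hε hL
  have hnk : n = k₀ := by
    have hmem : min ε L / 2 ∈ Ioo 0 (min ε L) := ⟨half_pos hm, half_lt_self hm⟩
    rw [← hn _ ⟨hmem.1, hmem.2.trans_le (min_le_right _ _)⟩]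
    refine ((haff (h 0) k₀ 0 _).congr_of_eventuallyEq ?_).deriv
    filter_upwards [isOpen_Ioo.mem_nhds hmem] with s hs
    exact hεs ⟨hs.1.le, hs.2.trans_le (min_le_left _ _)⟩
  have hder : ∀ x ∈ Ico 0 L, HasDerivWithinAt h k₀ (Ici x) x := by
    intro x hx
    rcases hx.1.eq_or_lt with rfl | hx0
    · exact (haff (h 0) k₀ 0 0).hasDerivWithinAt.congr_of_eventuallyEq h0 (by simp)
    · obtain ⟨k, hk⟩ := hd x ⟨hx0, hx.2⟩
      rw [← hnk, ← hn x ⟨hx0, hx.2⟩]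
      exact hk.self_of_nhds.differentiableAt.hasDerivAt.hasDerivWithinAt
  have := constant_of_has_deriv_right_zero (f := fun s => h s - k₀ * s)
    (hc.sub (by fun_prop)) (fun x hx => by
      simpa using (hder x hx).fun_sub ((hasDerivWithinAt_id x (Ici x)).const_mul k₀)) L ⟨hL.le, le_rfl⟩
  simp only [mul_zero, sub_zero] at this
  linarith

section EdgePosition

variable {Γ : MetricGraph V E}

open Classical in
/-- The distance from the tail of `e` for points in the interior of `e`, zero elsewhere. -/
noncomputable def edgePosition (e : E) : Γ.Point → ℝ
  | Point.vertex _ => 0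
  | Point.interior e' t _ _ => if e' = e then t else 0

open Classical in
/-- For a point `x` in the interior of `e`, the function on `e` that is zero up to `x` and
has slope one from there on. -/
noncomputable def ramp (e : E) (s : ℝ) : Γ.Point → ℝ
  | Point.vertex _ => 0
  | Point.interior e' t _ _ => if e' = e then max (s - t) 0 else 0

open Classical in
/-- The slope of `ramp` to the right of `s`. -/
noncomputable def rampForward (e : E) (s : ℝ) : Γ.Point → ℤ
  | Point.vertex _ => 0
  | Point.interior e' t _ _ => if e' = e ∧ t ≤ s then 1 else 0

open Classical in
/-- The slope of `ramp` to the left of `s`. -/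
noncomputable def rampBackward (e : E) (s : ℝ) : Γ.Point → ℤ
  | Point.vertex _ => 0
  | Point.interior e' t _ _ => if e' = e ∧ t < s then 1 else 0

theorem ramp_eventually_right (e : E) (s : ℝ) (x : Γ.Point) :
    ∀ᶠ s' in 𝓝[≥] s, ramp e s' x = ramp e s x + rampForward e s x * (s' - s) := by
  cases x with
  | vertex v => simp [ramp, rampForward]
  | interior e' t h₀ h₁ =>
    by_cases he : e' = e
    swap
    · simp [ramp, rampForward, he]
    by_cases ht : t ≤ s
    · filter_upwards [self_mem_nhdsWithin] with s' hs'
      have hs' : s ≤ s' := hs'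
      simp only [ramp, rampForward, he, ht, if_true, and_self]
      rw [max_eq_left (by linarith), max_eq_left (by linarith)]
      push_cast
      ring
    · filter_upwards [Icc_mem_nhdsGE (not_le.1 ht)] with s' hs'
      simp only [ramp, rampForward, he, ht, if_true, and_false, if_false]
      rw [max_eq_right (by linarith [hs'.2]), max_eq_right (by linarith)]
      simp

theorem ramp_eventually_left (e : E) (s : ℝ) (x : Γ.Point) :
    ∀ᶠ s' in 𝓝[≤] s, ramp e s' x = ramp e s x + rampBackward e s x * (s' - s) := by
  cases x with
  | vertex v => simp [ramp, rampBackward]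
  | interior e' t h₀ h₁ =>
    by_cases he : e' = e
    swap
    · simp [ramp, rampBackward, he]
    by_cases ht : t < s
    · filter_upwards [Icc_mem_nhdsLE ht] with s' hs'
      simp only [ramp, rampBackward, he, ht, if_true, and_self]
      rw [max_eq_left (by linarith [hs'.1]), max_eq_left (by linarith)]
      push_cast
      ring
    · filter_upwards [self_mem_nhdsWithin] with s' hs'
      have hs' : s' ≤ s := hs'
      simp only [ramp, rampBackward, he, ht, if_true, and_false, if_false]
      rw [max_eq_right (by linarith), max_eq_right (by linarith)]
      simp

/-- Only the ramp starting at `s` itself changes slope there, so the total slope jumps by the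
coefficient of `D` at that point. -/
theorem sum_rampForward_sub (D : Γ.Divisor) (e : E) {s : ℝ} (h₀ : 0 < s) (h₁ : s < Γ.length e) :
    ∑ x ∈ D.support, D x * rampForward e s x =
      ∑ x ∈ D.support, D x * rampBackward e s x + D (Point.interior e s h₀ h₁) := by
  classical
  have h : ∀ x : Γ.Point, rampForward e s x =
      rampBackward e s x + if x = Point.interior e s h₀ h₁ then 1 else 0 := by
    intro x
    cases x with
    | vertex v => simp [rampForward, rampBackward]
    | interior e' t _ _ =>
      by_cases he : e' = e
      · rcases lt_trichotomy t s with ht | rfl | ht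
        · simp [rampForward, rampBackward, he, ht, ht.le, ht.ne]
        · simp [rampForward, rampBackward, he]
        · simp [rampForward, rampBackward, he, ht.not_ge, ht.not_gt, ht.ne']
      · simp [rampForward, rampBackward, he]
  simp only [h, mul_add, Finset.sum_add_distrib, mul_ite, mul_one, mul_zero, Finset.sum_ite_eq']
  simp [eq_comm]

theorem continuous_ramp (e : E) (x : Γ.Point) : Continuous fun s => ramp e s x := by
  cases x with
  | vertex v => exact continuous_const
  | interior e' t _ _ =>
    simp only [ramp]
    split_ifs <;> fun_prop

/-- Adding the ramps weighted by `D` cancels every break of `f` inside `e`, leaving an affine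
function with integer slope. Comparing its values at the two ends gives the formula. -/
theorem exists_sum_edgePosition_eq [Fintype E] {f : Γ.Point → ℝ} (hf : Γ.IsPLInt f)
    {D : Γ.Divisor} (hD : Γ.IsDivisorOf f D) (e : E) :
    ∃ k : ℤ, ∑ x ∈ D.support, D x * edgePosition e x =
      f (Point.vertex (Γ.head e)) - f (Point.vertex (Γ.tail e)) + k * Γ.length e := by
  have hL := Γ.length_pos e
  set h : ℝ → ℝ := fun s => f (Γ.edgePath e s) + ∑ x ∈ D.support, D x * ramp e s x with hh
  have hright : ∀ t, 0 ≤ t → t < Γ.length e → ∀ n : ℤ,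
      (∀ᶠ s in 𝓝[≥] t, f (Γ.edgePath e s) = f (Γ.edgePath e t) + n * (s - t)) →
      ∀ᶠ s in 𝓝[≥] t, h s = h t +
        ((n + ∑ x ∈ D.support, D x * rampForward e t x : ℤ) : ℝ) * (s - t) := by
    intro t h₀ h₁ n hn
    filter_upwards [hn, (eventually_all_finset D.support).2
      fun x _ => ramp_eventually_right e t x] with s hs hs'
    simp only [hh]
    rw [hs, Finset.sum_congr rfl fun x hx => by rw [hs' x hx]]
    push_cast
    simp only [mul_add, Finset.sum_add_distrib, add_mul, Finset.sum_mul, mul_assoc]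
    ring
  have hleft : ∀ t, 0 < t → t ≤ Γ.length e → ∀ n : ℤ,
      (∀ᶠ s in 𝓝[≤] t, f (Γ.edgePath e s) = f (Γ.edgePath e t) + n * (s - t)) →
      ∀ᶠ s in 𝓝[≤] t, h s = h t +
        ((n + ∑ x ∈ D.support, D x * rampBackward e t x : ℤ) : ℝ) * (s - t) := by
    intro t h₀ h₁ n hn
    filter_upwards [hn, (eventually_all_finset D.support).2
      fun x _ => ramp_eventually_left e t x] with s hs hs'
    simp only [hh]
    rw [hs, Finset.sum_congr rfl fun x hx => by rw [hs' x hx]]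
    push_cast
    simp only [mul_add, Finset.sum_add_distrib, add_mul, Finset.sum_mul, mul_assoc]
    ring
  obtain ⟨n₀, hn₀⟩ := hf.eventually_right e le_rfl hL
  have key := eq_affine_of_eventually_affine (h := h) hL ?_ (hright 0 le_rfl hL n₀ hn₀) ?_
  · set k := n₀ + ∑ x ∈ D.support, D x * rampForward e 0 x
    have h0 : ∑ x ∈ D.support, (D x : ℝ) * ramp e 0 x = 0 := by
      refine Finset.sum_eq_zero fun x _ => ?_
      cases x with
      | vertex v => simp [ramp]
      | interior e' t h₀ h₁ => simp [ramp, h₀.le]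
    -- At the head every ramp on `e` has started, so `rampForward` merely marks the interior points
    -- of `e`.
    have h1 : ∑ x ∈ D.support, (D x : ℝ) * ramp e (Γ.length e) x =
        ((∑ x ∈ D.support, D x * rampForward e (Γ.length e) x : ℤ) : ℝ) * Γ.length e
          - ∑ x ∈ D.support, D x * edgePosition e x := by
      push_cast
      rw [Finset.sum_mul, ← Finset.sum_sub_distrib]
      refine Finset.sum_congr rfl fun x _ => ?_
      cases x with
      | vertex v => simp [ramp, rampForward, edgePosition]
      | interior e' t h₀ h₁ =>
        by_cases he : e' = e
        · subst he
          simp [ramp, rampForward, edgePosition, h₁.le]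
          ring
        · simp [ramp, rampForward, edgePosition, he]
    simp only [hh] at key
    rw [h0, h1, edgePath_zero, edgePath_length] at key
    refine ⟨(∑ x ∈ D.support, D x * rampForward e (Γ.length e) x) - k, ?_⟩
    rw [Int.cast_sub]
    linear_combination -key
  · exact (continuous_iff_edgePath.1 hf.1 e).add
      (continuous_finsetSum _ fun x _ => continuous_const.mul (continuous_ramp e x)).continuousOn
  · intro t ht
    obtain ⟨n, hn⟩ := hf.eventually_right e ht.1.le ht.2
    obtain ⟨m, hm⟩ := hf.eventually_left e ht.1 ht.2.le
    have hDt := hD (Point.interior e t ht.1 ht.2)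
    rw [outgoingSlopes, slopeForward_eq hn, slopeBackward_eq hm] at hDt
    have hDt : D (Point.interior e t ht.1 ht.2) = -(n + -m) := by exact_mod_cast hDt
    refine ⟨((n + ∑ x ∈ D.support, D x * rampForward e t x : ℤ) : ℝ), ?_⟩
    -- The right slope `n` and left slope `m` of `f` satisfy `D x = m - n`, exactly offsetting the
    -- jump of the ramps; both sides thus share one slope.
    rw [← nhdsLE_sup_nhdsGE, eventually_sup]
    refine ⟨?_, hright t ht.1.le ht.2 n hn⟩
    convert hleft t ht.1 ht.2.le m hm using 6
    rw [sum_rampForward_sub D e ht.1 ht.2, hDt]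
    ring

end EdgePosition

/-! ### A circulation separates infinitely many points -/

section Infinite

variable [Fintype V] [Fintype E] {Γ : MetricGraph V E}

/-- Otherwise the divergence is injective, so genus at least one forces `#E = #V` and surjectivity.
But every divergence sums to zero over the vertices. -/
theorem exists_divergence_eq_zero (hgenus : 1 ≤ Γ.genus) :
    ∃ z : E → ℚ, z ≠ 0 ∧ Γ.divergence z = 0 := by
  classical
  by_contra! hn
  have hinj : Function.Injective (Γ.divergence (R := ℚ)) :=
    (injective_iff_map_eq_zero _).2 fun z hz => by_contra fun h => hn z h hz
  have hle := LinearMap.finrank_le_finrank_of_injective hinj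
  simp only [Module.finrank_fintype_fun_eq_card] at hle
  have hcard : Fintype.card E = Fintype.card V := by
    unfold genus at hgenus
    omega
  have hsurj := (LinearMap.injective_iff_surjective_of_finrank_eq_finrank
    (f := Γ.divergence (R := ℚ)) (by simpa using hcard)).1 hinj
  obtain ⟨v⟩ := Γ.nonempty
  obtain ⟨z, hz⟩ := hsurj (Pi.single v 1)
  have := Γ.sum_mul_divergence z fun _ => 1
  simp [hz] at this

/-- Weighting the edge formulas by a circulation cancels the vertex values of `f`; only integer
multiples of the numbers `M * z e * ℓ e` remain. -/
theorem exists_int_sum_eq {z : E → ℚ} (hz : Γ.divergence z = 0) {r : E → ℚ}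
    (hr : ∀ e, Γ.length e = r e) {M : ℕ} (hM : ∀ e, ∃ c : ℤ, (M : ℚ) * (z e * r e) = c)
    {D : Γ.Divisor} (hD : D ∈ Γ.principal) :
    ∃ k : ℤ, M * ∑ e, z e * ∑ x ∈ D.support, D x * edgePosition e x = k := by
  obtain ⟨f, hf, hfD⟩ := hD
  choose k hk using exists_sum_edgePosition_eq hf hfD
  choose c hc using hM
  have hflow : ∑ e, (z e : ℝ) *
      (f (Point.vertex (Γ.tail e)) - f (Point.vertex (Γ.head e))) = 0 := by
    rw [← sum_mul_divergence Γ (fun e => (z e : ℝ)) fun v => f (Point.vertex v)]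
    refine Finset.sum_eq_zero fun v _ => ?_
    have := Γ.map_divergence (Rat.castHom ℝ) z v
    simp only [hz, Pi.zero_apply, map_zero, Rat.coe_castHom] at this
    rw [← this, mul_zero]
  refine ⟨∑ e, c e * k e, ?_⟩
  have hcM : ∀ e, (c e : ℝ) = M * (z e * r e) := fun e => by exact_mod_cast (hc e).symm
  push_cast
  rw [← add_zero (_ * _), ← mul_zero (M : ℝ), ← hflow, ← mul_add, ← Finset.sum_add_distrib,
    Finset.mul_sum]
  refine Finset.sum_congr rfl fun e _ => ?_
  rw [hk, hcM, hr]
  ring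

/-- If two points of an edge in the support of `z` are equivalent, `M * z e` times their distance is
an integer; for points close enough together it must vanish. -/
theorem exists_injective_pointClass_edgePath (hgenus : 1 ≤ Γ.genus)
    (hrat : ∀ e, ∃ r : ℚ, Γ.length e = r) :
    ∃ (e : E) (q : ℕ → ℚ), Function.Injective fun n => Γ.pointClass (Γ.edgePath e (q n)) := by
  obtain ⟨z, hz0, hz⟩ := exists_divergence_eq_zero hgenus
  obtain ⟨e, he⟩ := Function.ne_iff.1 hz0
  have he : z e ≠ 0 := he
  choose r hr using hrat
  obtain ⟨M, hM, hMz⟩ := exists_common_denominator fun e => z e * r e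
  have hr0 : 0 < r e := by
    have := Γ.length_pos e
    rw [hr] at this
    exact_mod_cast this
  have hMz0 : 0 < M * |z e| := mul_pos (by exact_mod_cast hM) (abs_pos.2 he)
  -- The first bound keeps the points inside the edge. The second makes the pairing of a difference
  -- smaller than one in absolute value, since two positions in `(0, δ]` differ by less than `δ`.
  set δ := min (r e / 2) (M * |z e|)⁻¹ with hδ
  have hδ0 : 0 < δ := lt_min (half_pos hr0) (inv_pos.2 hMz0)
  have hδr : δ < r e := (min_le_left _ _).trans_lt (half_lt_self hr0)
  have hδM : M * |z e| * δ ≤ 1 :=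
    (mul_le_mul_of_nonneg_left (min_le_right _ _) hMz0.le).trans_eq (mul_inv_cancel₀ hMz0.ne')
  set q : ℕ → ℚ := fun n => δ / (n + 1) with hq
  have hq0 : ∀ n, 0 < q n := fun n => div_pos hδ0 (by positivity)
  have hqδ : ∀ n, q n ≤ δ := fun n => div_le_self hδ0.le (by simp)
  refine ⟨e, q, fun i j hij => ?_⟩
  have hpos : ∀ n, 0 < (q n : ℝ) := fun n => by exact_mod_cast hq0 n
  have hlt : ∀ n, (q n : ℝ) < Γ.length e := fun n => by
    rw [hr]; exact_mod_cast (hqδ n).trans_lt hδr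
  simp only [edgePath_of_mem_Ioo e (hpos _) (hlt _)] at hij
  have hD : (Finsupp.single (Point.interior e (q i) (hpos i) (hlt i)) 1
      - Finsupp.single (Point.interior e (q j) (hpos j) (hlt j)) 1 : Γ.Divisor) ∈ Γ.principal := by
    rw [← divisorClass_eq_zero_iff, divisorClass, map_sub]
    exact sub_eq_zero.2 hij
  obtain ⟨k, hk⟩ := exists_int_sum_eq hz hr hMz hD
  have hsum : ∀ e', ∑ x ∈ (Finsupp.single (Point.interior e (q i) (hpos i) (hlt i)) 1
      - Finsupp.single (Point.interior e (q j) (hpos j) (hlt j)) 1 : Γ.Divisor).support,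
      (((Finsupp.single (Point.interior e (q i) (hpos i) (hlt i)) 1
      - Finsupp.single (Point.interior e (q j) (hpos j) (hlt j)) 1 : Γ.Divisor) x : ℤ) : ℝ)
        * edgePosition e' x
      = edgePosition e' (Point.interior e (q i) (hpos i) (hlt i))
        - edgePosition e' (Point.interior e (q j) (hpos j) (hlt j)) := by
    intro e'
    have := Finsupp.sum_sub_index (f := Finsupp.single (Point.interior e (q i) (hpos i) (hlt i)) 1)
      (g := Finsupp.single (Point.interior e (q j) (hpos j) (hlt j)) 1)
      (h := fun x (n : ℤ) => (n : ℝ) * edgePosition e' x) (fun x b c => by push_cast; ring)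
    rw [Finsupp.sum_single_index (by simp), Finsupp.sum_single_index (by simp)] at this
    simpa [Finsupp.sum] using this
  simp only [hsum] at hk
  rw [Finset.sum_eq_single e (fun e' _ h => by simp [edgePosition, Ne.symm h]) (by simp)] at hk
  simp only [edgePosition, if_true] at hk
  have hk : (M : ℚ) * (z e * (q i - q j)) = k := by exact_mod_cast hk
  have hk1 : |(k : ℚ)| < 1 := by
    rw [← hk, abs_mul, abs_mul, Nat.abs_cast, ← mul_assoc]
    refine lt_of_lt_of_le (mul_lt_mul_of_pos_left ?_ hMz0) hδM
    rw [abs_lt]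
    constructor <;> linarith [hq0 i, hq0 j, hqδ i, hqδ j]
  have hk0 : k = 0 := Int.abs_lt_one_iff.1 (by exact_mod_cast hk1)
  have hij' : q i = q j := by
    rw [hk0, Int.cast_zero] at hk
    have hM' : (M : ℚ) ≠ 0 := by exact_mod_cast hM.ne'
    simpa [hM', he, sub_eq_zero] using hk
  have h2 : ((i : ℚ) + 1) = j + 1 := by
    simp only [hq] at hij'
    field_simp at hij'
    linarith
  exact_mod_cast add_right_cancel h2

end Infinite

/-! ### Abel–Jacobi images and torsion packets -/

section AbelJacobi

variable [Fintype E] {Γ : MetricGraph V E}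

theorem pointClass_mem_Eff (x : Γ.Point) : Γ.pointClass x ∈ Γ.Eff 1 :=
  ⟨Finsupp.single x 1, fun y => by classical rw [Finsupp.single_apply]; split_ifs <;> simp,
    by simp [degree], rfl⟩

theorem coe_abelJacobi (q x : Γ.Point) :
    (Γ.abelJacobi q x : Γ.Pic) = Γ.pointClass x - Γ.pointClass q := by
  simp [abelJacobi, pointClass, divisorClass]

theorem isOfFinAddOrder_abelJacobi_iff {q x : Γ.Point} :
    IsOfFinAddOrder (Γ.abelJacobi q x) ↔
      IsOfFinAddOrder (Γ.pointClass x - Γ.pointClass q) := by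
  rw [← coe_abelJacobi]
  exact (AddSubmonoid.isOfFinAddOrder_coe (H := Γ.Jac.toAddSubmonoid)).symm

theorem pointClass_mem_torsionPacket {q x : Γ.Point}
    (h : IsOfFinAddOrder (Γ.pointClass x - Γ.pointClass q)) :
    Γ.pointClass x ∈ Γ.torsionPacket 1 (Γ.pointClass q) :=
  ⟨pointClass_mem_Eff x, Γ.abelJacobi q x, isOfFinAddOrder_abelJacobi_iff.2 h,
    (coe_abelJacobi q x).symm⟩

end AbelJacobi

end MetricGraph

/-! ### The main theorem -/

theorem mainTheorem9 {V E : Type*} [Fintype V] [Fintype E] (Γ : MetricGraph V E)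
    (hgenus : 1 ≤ Γ.genus) (hrat : ∀ e, ∃ r : ℚ, Γ.length e = r) :
    ¬ Γ.ManinMumford ∧
      ∃ c ∈ Γ.Eff 1,
        (∀ m : ℕ, 0 < m → (∀ e, ∃ n : ℕ, (m : ℝ) * Γ.length e = n) →
          ∀ x ∈ Γ.subdivisionVertices m, Γ.pointClass x ∈ Γ.torsionPacket 1 c) ∧
        (Γ.torsionPacket 1 c).Infinite := by
  obtain ⟨v⟩ := Γ.nonempty
  obtain ⟨e, q, hinj⟩ := MetricGraph.exists_injective_pointClass_edgePath hgenus hrat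
  -- One vertex `v` serves as the basepoint and as the centre of the packet, and one sequence of
  -- points witnesses both infinitude claims.
  have htors := fun n => MetricGraph.isOfFinAddOrder_edgePath_sub hrat e (q n) v
  refine ⟨fun hMM => ?_, Γ.pointClass (MetricGraph.Point.vertex v), MetricGraph.pointClass_mem_Eff _,
    fun m _ _ x hx => MetricGraph.pointClass_mem_torsionPacket ?_, ?_⟩
  · refine Set.infinite_of_injective_forall_mem
      (f := fun n => Γ.abelJacobi (MetricGraph.Point.vertex v) (Γ.edgePath e (q n))) (fun i j hij => ?_)
      (s := range (Γ.abelJacobi (MetricGraph.Point.vertex v)) ∩ {c : Γ.Jac | IsOfFinAddOrder c})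
      (fun n => ⟨mem_range_self _, MetricGraph.isOfFinAddOrder_abelJacobi_iff.2 (htors n)⟩)
      (hMM (MetricGraph.Point.vertex v))
    have := congrArg (Subtype.val) hij
    simp only [MetricGraph.coe_abelJacobi] at this
    exact hinj (sub_left_injective this)
  · rcases hx with ⟨w, rfl⟩ | ⟨e', j, _, rfl⟩
    · exact MetricGraph.isOfFinAddOrder_vertex_sub hrat w v
    · simpa using MetricGraph.isOfFinAddOrder_edgePath_sub hrat e' ((j : ℚ) / m) v
  · exact Set.infinite_of_injective_forall_mem hinj fun n =>
      MetricGraph.pointClass_mem_torsionPacket (htors n)
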